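/- A hypergraph $\mathcal H=(X,E)$ consists of a finite non-empty vertex set $X$ and a set $E$ of subsets of $X$; it is $r$-uniform if $|e|=r$ for all $e\in E$, and linear if any two distinct edges share at most one vertex. A path is a sequence of edges in which consecutive edges intersect, and $\mathcal H$ is connected if any two distinct vertices lie on a common path. A cycle consists of $l\ge 3$ distinct edges $e_1,\dots,e_l$ for which there are distinct vertices $v_1,\dots,v_l$ with $v_i\in e_i\cap e_{i+1}$ for $1\le i<l$ and $v_l\in e_l\cap e_1$. A hypertree is a connected linear hypergraph without cycles (a single vertex without edges is one). For an integer $k\ge 1$, a $k$-fold cover of $\mathcal H$ is a family $\mathcal F$ of partial maps from $X$ to $\{1,\dots,k\}$, each having an edge of $\mathcal H$ as its domain, such that any two distinct $\varphi,\psi\in\mathcal F$ with the same domain satisfy $\varphi\cap\psi=\emptyset$ (as graphs of maps). An $\mathcal F$-coloring is a map $f:X\to\{1,\dots,k\}$ with $\varphi\not\subseteq f$ for every $\varphi\in\mathcal F$. The DP color function $P_{DP}(\mathcal H,k)$ is the minimum, over all $k$-fold covers $\mathcal F$ of $\mathcal H$, of the number of $\mathcal F$-colorings. Theorem. Let $r\ge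 2$ and let $\mathcal H$ be a connected $r$-uniform hypergraph with $n$ vertices and $m$ edges. Then $$P_{DP}(\mathcal H,k)=\frac{k^{n}\,(k^{r-1}-1)^{m}}{k^{(r-1)m}}\qquad(\ast)$$ holds for every integer $k\ge 1$ if and only if $\mathcal H$ is a hypertree. Moreover, for each single integer $k\ge 2$, $(\ast)$ holds for that $k$ if and only if $\mathcal H$ is a hypertree. -/

import Mathlib

namespace Hypergraph

/-- `H` is `r`-uniform: every edge has exactly `r` vertices. -/
def IsUniform {α : Type*} (H : Hypergraph α) (r : ℕ) : Prop :=
  ∀ e ∈ H.edgeSet, e.ncard = r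

/-- `H` is linear: two distinct edges share at most one vertex. -/
def IsLinear {α : Type*} (H : Hypergraph α) : Prop :=
  ∀ e ∈ H.edgeSet, ∀ f ∈ H.edgeSet, e ≠ f → (e ∩ f).Subsingleton

/-- A path of `H`, as the list of its edges: consecutive edges meet. -/
def IsPath {α : Type*} (H : Hypergraph α) (P : List (Set α)) : Prop :=
  (∀ e ∈ P, e ∈ H.edgeSet) ∧ P.IsChain (fun e f => (e ∩ f).Nonempty)

/-- `H` is connected: any two distinct vertices lie on a common path. -/
def IsConnected {α : Type*} (H : Hypergraph α) : Prop :=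
  ∀ u ∈ H.vertexSet, ∀ v ∈ H.vertexSet, u ≠ v →
    ∃ P : List (Set α), H.IsPath P ∧ (∃ e ∈ P, u ∈ e) ∧ (∃ e ∈ P, v ∈ e)

/-- The distinct edges `e 0, …, e (l - 1)` of `H`, where `l ≥ 3`, form a cycle, with distinct
vertices `v i` in the intersection of `e i` and the cyclically next edge. -/
def IsCycle {α : Type*} (H : Hypergraph α) (l : ℕ) (e : Fin l → Set α) (v : Fin l → α) : Prop :=
  3 ≤ l ∧ Function.Injective e ∧ Function.Injective v ∧ (∀ i, e i ∈ H.edgeSet) ∧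
    ∀ i, v i ∈ e i ∧ v i ∈ e (finRotate l i)

/-- A hypertree is a connected linear hypergraph without cycles. -/
def IsHypertree {α : Type*} (H : Hypergraph α) : Prop :=
  H.IsConnected ∧ H.IsLinear ∧
    ¬ ∃ (l : ℕ) (e : Fin l → Set α) (v : Fin l → α), H.IsCycle l e v

/-- A `k`-fold cover of `H`: a family of partial maps from the vertices to the `k` colors, each
with an edge of `H` as its domain, such that distinct members with the same domain have disjoint
graphs. -/
def IsCover {α : Type*} (H : Hypergraph α) (k : ℕ) (F : Set (H.vertexSet →. Fin k)) : Prop :=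
  (∀ φ ∈ F, (Subtype.val '' φ.Dom : Set α) ∈ H.edgeSet) ∧
    ∀ φ ∈ F, ∀ ψ ∈ F, φ ≠ ψ → φ.Dom = ψ.Dom → φ.graph ∩ ψ.graph = ∅

/-- The `F`-colorings of `H`: the total maps `f` that avoid every member of `F`, that is, whose
graph contains the graph of no member of `F`. -/
def coverColorings {α : Type*} (H : Hypergraph α) (k : ℕ) (F : Set (H.vertexSet →. Fin k)) :
    Set (H.vertexSet → Fin k) :=
  {f | ∀ φ ∈ F, ¬ φ.graph ⊆ (f : H.vertexSet →. Fin k).graph}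

/-- The DP color function: the minimum number of `F`-colorings over all `k`-fold covers `F`.
(The empty family is a cover, so the minimum is over a nonempty set of natural numbers.) -/
noncomputable def dpColorFunction {α : Type*} (H : Hypergraph α) (k : ℕ) : ℕ :=
  sInf {N | ∃ F : Set (H.vertexSet →. Fin k), H.IsCover k F ∧ N = (H.coverColorings k F).ncard}

end Hypergraph

/-! The upper bound is an average. Give each edge a random map together with all its translates by
colors. A fixed `f` contains a translate on a given edge with probability `1 / k ^ (r - 1)`,
independently over the edges, so the mean number of colorings is the right-hand side of (∗).

If (∗) holds for some `k ≥ 2`, every such shift cover attains the mean. Averaging over part of the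
choices (`sum_prod_subset_eq`) and then inclusion-exclusion (`sum_prod_one_sub_eq`) determine how
many maps are blocked on every edge. For the zero shifts these are the maps constant on each edge,
of which a connected hypergraph has `k`. Hence `n = (r - 1) * m + 1`, and growing the vertex set
edge by edge shows that a cycle or a failure of linearity would leave too few vertices.

Conversely, a hypertree can be built by adding edges that each meet the earlier part in one vertex.
By `IsCover.ncard_partialColorings_insert`, each costs at most the fraction `1 / k ^ (r - 1)` of the
colorings, whatever the cover. -/

namespace Hypergraph

/-! ### Counting and averaging over independent choices -/

section Counting

open Finset

/-- If modifying a member of `B` on `T` always yields a member of `G`, and members of `B` are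
determined by their values outside `T`, then `B` is smaller than `G` by the factor `|κ| ^ |T|`. -/
theorem card_mul_pow_le_of_modify {V κ : Type*} [Fintype κ]
    (T : Finset V) (B G : Finset (V → κ))
    (hG : ∀ f ∈ B, ∀ g : V → κ, (∀ x ∉ T, g x = f x) → g ∈ G)
    (hB : ∀ f ∈ B, ∀ g ∈ B, (∀ x ∉ T, f x = g x) → f = g) :
    B.card * Fintype.card κ ^ T.card ≤ G.card := by
  classical
  have hc : (B ×ˢ (univ : Finset (T → κ))).card = B.card * Fintype.card κ ^ T.card := by
    simp [card_product]
  rw [← hc]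
  refine card_le_card_of_injOn
    (fun p x => if h : x ∈ T then p.2 ⟨x, h⟩ else p.1 x) ?_ ?_
  · rintro ⟨f, g⟩ hp
    simp only [coe_product, Set.mem_prod, mem_coe] at hp
    exact hG f hp.1 _ fun x hx => by simp [hx]
  · rintro ⟨f, g⟩ hp ⟨f', g'⟩ hp' h
    simp only [coe_product, Set.mem_prod, mem_coe] at hp hp'
    have hf : f = f' := hB f hp.1 f' hp'.1 fun x hx => by
      have := congrFun h x
      simpa [hx] using this
    have hg : g = g' := by
      funext x
      have := congrFun h x
      simpa using this
    rw [hf, hg]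

/-- The equality case of `card_mul_pow_le_of_modify`. -/
theorem card_mul_pow_eq_of_modify {V κ : Type*} [Fintype κ]
    (T : Finset V) (B G : Finset (V → κ))
    (hG : ∀ f ∈ B, ∀ g : V → κ, (∀ x ∉ T, g x = f x) → g ∈ G)
    (hB : ∀ f ∈ B, ∀ g ∈ B, (∀ x ∉ T, f x = g x) → f = g)
    (hs : ∀ g ∈ G, ∃ f ∈ B, ∀ x ∉ T, g x = f x) :
    B.card * Fintype.card κ ^ T.card = G.card := by
  classical
  refine le_antisymm (card_mul_pow_le_of_modify T B G hG hB) ?_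
  have hc : (B ×ˢ (univ : Finset (T → κ))).card = B.card * Fintype.card κ ^ T.card := by
    simp [card_product]
  rw [← hc]
  refine card_le_card_of_surjOn
    (fun p x => if h : x ∈ T then p.2 ⟨x, h⟩ else p.1 x) ?_
  intro g hg
  obtain ⟨f, hf, hfg⟩ := hs g hg
  refine ⟨(f, fun x => g x), by simpa using hf, ?_⟩
  funext x
  by_cases hx : x ∈ T <;> simp [hx, hfg]

/-- Averaging a sum of products over independent choices in each factor. -/
theorem sum_sum_prod_eq {I S T : Type*} [Fintype I] [DecidableEq I] [Fintype S] [Fintype T]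
    (x : I → S → T → ℚ) (p : ℚ) (hx : ∀ i t, ∑ s, x i s t = Fintype.card S * p) :
    ∑ σ : I → S, ∑ t, ∏ i, x i (σ i) t =
      Fintype.card T * (Fintype.card S * p) ^ Fintype.card I := by
  rw [sum_comm]
  have h : ∀ t, ∑ σ : I → S, ∏ i, x i (σ i) t = (Fintype.card S * p) ^ Fintype.card I := by
    intro t
    have := (Finset.prod_univ_sum (fun _ : I => (univ : Finset S)) fun i s => x i s t)
    rw [Fintype.piFinset_univ] at this
    rw [← this]
    simp [hx]
  simp [h]

/-- If a sum of products does not depend on the choices, then neither do the sums of the partial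
products. -/
theorem sum_prod_subset_eq {I S T : Type*} [Fintype I] [DecidableEq I] [Fintype S] [Nonempty S]
    [Fintype T] (x : I → S → T → ℚ) (p : ℚ) (hp : p ≠ 0)
    (hx : ∀ i t, ∑ s, x i s t = Fintype.card S * p)
    (hσ : ∀ σ : I → S, ∑ t, ∏ i, x i (σ i) t = Fintype.card T * p ^ Fintype.card I)
    (σ : I → S) (A : Finset I) :
    ∑ t, ∏ i ∈ A, x i (σ i) t = Fintype.card T * p ^ A.card := by
  classical
  -- Freeze the choices on `A` and let the others vary. The resulting sum is computed twice: by `hσ`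
  -- each term is constant, and by `hx` each free factor averages out.
  set P : I → Finset S := fun i => if i ∈ A then {σ i} else univ with hP
  have hS : (Fintype.card S : ℚ) ≠ 0 := by simp
  have h1 : ∑ τ ∈ Fintype.piFinset P, ∑ t, ∏ i, x i (τ i) t =
      (Fintype.card S : ℚ) ^ Aᶜ.card * (Fintype.card T * p ^ Fintype.card I) := by
    simp only [hσ, sum_const, nsmul_eq_mul]
    congr 1
    rw [Fintype.card_piFinset]
    push_cast
    rw [← prod_mul_prod_compl A]
    rw [prod_congr rfl (g := fun _ => (1 : ℚ)) (fun i hi => by simp [hP, hi]),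
      prod_congr (s₁ := Aᶜ) rfl (g := fun _ => (Fintype.card S : ℚ))
        (fun i hi => by rw [mem_compl] at hi; simp [hP, hi])]
    simp
  have h2 : ∑ τ ∈ Fintype.piFinset P, ∑ t, ∏ i, x i (τ i) t =
      (∑ t, ∏ i ∈ A, x i (σ i) t) * (Fintype.card S * p) ^ Aᶜ.card := by
    rw [sum_comm, sum_mul]
    refine sum_congr rfl fun t _ => ?_
    rw [← Finset.prod_univ_sum P fun i s => x i s t, ← prod_mul_prod_compl A]
    congr 1
    · exact prod_congr rfl fun i hi => by simp [hP, hi]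
    · rw [prod_congr rfl (g := fun _ => (Fintype.card S * p : ℚ))
        (fun i hi => by rw [mem_compl] at hi; simp [hP, hi, hx])]
      simp
  have h3 := h1.symm.trans h2
  have hc : A.card + Aᶜ.card = Fintype.card I := card_add_card_compl A
  rw [← hc, mul_pow, pow_add] at h3
  have h4 : (Fintype.card S : ℚ) ^ Aᶜ.card * p ^ Aᶜ.card ≠ 0 := by positivity
  apply mul_right_cancel₀ h4
  linear_combination -h3

/-- If a sum of products does not depend on the choices, then neither does the sum of the products
of the complementary factors. -/
theorem sum_prod_one_sub_eq {I S T : Type*} [Fintype I] [DecidableEq I] [Fintype S] [Nonempty S]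
    [Fintype T] (x : I → S → T → ℚ) (p : ℚ) (hp : p ≠ 0)
    (hx : ∀ i t, ∑ s, x i s t = Fintype.card S * p)
    (hσ : ∀ σ : I → S, ∑ t, ∏ i, x i (σ i) t = Fintype.card T * p ^ Fintype.card I)
    (σ : I → S) :
    ∑ t, ∏ i, (1 - x i (σ i) t) = Fintype.card T * (1 - p) ^ Fintype.card I := by
  have h : ∀ t, ∏ i, (1 - x i (σ i) t) =
      ∑ A : Finset I, (-1) ^ A.card * ∏ i ∈ A, x i (σ i) t := by
    intro t
    have := Fintype.prod_add (fun i => - x i (σ i) t) fun _ => (1 : ℚ)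
    simp only [prod_const_one, mul_one, Finset.prod_neg] at this
    rw [← this]
    exact prod_congr rfl fun i _ => by ring
  simp only [h]
  rw [sum_comm]
  simp only [← mul_sum, sum_prod_subset_eq x p hp hx hσ σ]
  have := Fintype.sum_pow_mul_eq_add_pow I (-p) 1
  simp only [one_pow, mul_one] at this
  rw [show (1 : ℚ) - p = -p + 1 by ring, ← this, mul_sum]
  refine sum_congr rfl fun A _ => ?_
  rw [neg_pow p]
  ring

end Counting

end Hypergraph

namespace Hypergraph

/-! ### Vertex counts, links and cycles -/

section Structure

open Set

variable {α : Type*} {H : Hypergraph α}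

theorem edgeSet_finite (hfin : H.vertexSet.Finite) : H.edgeSet.Finite :=
  hfin.finite_subsets.subset fun _ he => H.subset_vertexSet_of_mem_edgeSet' he

/-- In a connected hypergraph some edge leaves any given nonempty proper set of vertices. -/
theorem IsConnected.exists_edge_leaving (hconn : H.IsConnected) {W : Set α}
    (hW : W ⊆ H.vertexSet) (hne : W.Nonempty) (hWV : W ≠ H.vertexSet) :
    ∃ e ∈ H.edgeSet, (e ∩ W).Nonempty ∧ ¬ e ⊆ W := by
  by_contra! hcon
  obtain ⟨u, hu⟩ := hne
  obtain ⟨v, hv, hvW⟩ := exists_of_ssubset (hW.ssubset_of_ne hWV)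
  obtain ⟨P, ⟨hPE, hP⟩, ⟨e, he, hue⟩, ⟨f, hf, hvf⟩⟩ :=
    hconn u (hW hu) v hv (fun h => hvW (h ▸ hu))
  -- If no edge leaves `W`, lying inside `W` passes between consecutive edges of a path.
  have hchain : P.IsChain (fun e f => e ⊆ W ↔ f ⊆ W) := by
    rw [List.isChain_iff_getElem] at hP ⊢
    intro i hi
    obtain ⟨x, hx1, hx2⟩ := hP i hi
    exact ⟨fun h => hcon _ (hPE _ (List.getElem_mem _)) ⟨x, hx2, h hx1⟩,
      fun h => hcon _ (hPE _ (List.getElem_mem _)) ⟨x, hx1, h hx2⟩⟩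
  have : Trans (fun e f : Set α => (e ⊆ W ↔ f ⊆ W)) (fun e f : Set α => (e ⊆ W ↔ f ⊆ W))
      (fun e f : Set α => (e ⊆ W ↔ f ⊆ W)) := ⟨fun h1 h2 => h1.trans h2⟩
  have : Std.Symm (fun e f : Set α => (e ⊆ W ↔ f ⊆ W)) := ⟨fun _ _ h => h.symm⟩
  have hall := hchain.pairwise.forall_of_forall
    (R := fun e f : Set α => (e ⊆ W ↔ f ⊆ W)) (fun _ _ => Iff.rfl) he hf
  exact hvW (hall.1 (hcon e (hPE e he) ⟨u, hue, hu⟩) hvf)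

/-- A connected uniform hypergraph has few vertices outside a given set of vertices that already
contains some of the edges. -/
theorem IsConnected.ncard_vertexSet_add_le {r : ℕ} (hfin : H.vertexSet.Finite)
    (hunif : H.IsUniform r) (hconn : H.IsConnected) (A : Set (Set α)) (W : Set α)
    (hA : A ⊆ H.edgeSet) (hW : W ⊆ H.vertexSet) (hne : W.Nonempty) (hAW : ∀ e ∈ A, e ⊆ W) :
    H.vertexSet.ncard + (r - 1) * A.ncard ≤ W.ncard + (r - 1) * H.edgeSet.ncard := by
  induction hd : H.vertexSet.ncard - W.ncard using Nat.strong_induction_on generalizing A W with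
  | _ d ih =>
  by_cases hWV : W = H.vertexSet
  · subst hWV
    have := ncard_le_ncard hA (edgeSet_finite hfin)
    gcongr
  · obtain ⟨e, he, ⟨x, hxe, hxW⟩, heW⟩ := hconn.exists_edge_leaving hW hne hWV
    have heV := H.subset_vertexSet_of_mem_edgeSet' he
    have hWfin := hfin.subset hW
    have hefin := hfin.subset heV
    have hlt : W.ncard < (W ∪ e).ncard :=
      ncard_lt_ncard ⟨subset_union_left, fun h => heW (subset_union_right.trans h)⟩
        (hWfin.union hefin)
    have hle : (W ∪ e).ncard ≤ H.vertexSet.ncard := ncard_le_ncard (union_subset hW heV) hfin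
    -- The vertex `x` is already in `W`, so `e` adds at most `r - 1` vertices while `A` gains one
    -- edge.
    have hub : (W ∪ e).ncard ≤ W.ncard + (r - 1) := by
      have h1 : W ∪ e = W ∪ (e \ {x}) := by
        ext y
        by_cases hy : y = x <;> simp [hy, hxW]
      have h2 : (e \ {x}).ncard = r - 1 := by
        rw [ncard_sdiff_singleton_of_mem hxe, hunif e he]
      rw [h1, ← h2]
      exact ncard_union_le _ _
    have heA : e ∉ A := fun h => heW (hAW e h)
    have := ih _ (by omega) (insert e A) (W ∪ e) (insert_subset he hA) (union_subset hW heV)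
      (hne.mono subset_union_left) (by
        rintro f (rfl | hf)
        · exact subset_union_right
        · exact (hAW f hf).trans subset_union_left) rfl
    rw [ncard_insert_of_notMem heA ((edgeSet_finite hfin).subset hA), mul_add] at this
    omega

/-- A connected uniform hypergraph with as many vertices as possible is a hypertree. -/
theorem IsConnected.isHypertree_of_ncard {r : ℕ} (hr : 2 ≤ r) (hfin : H.vertexSet.Finite)
    (hunif : H.IsUniform r) (hconn : H.IsConnected)
    (hcard : H.vertexSet.ncard = (r - 1) * H.edgeSet.ncard + 1) : H.IsHypertree := by
  refine ⟨hconn, ?_, ?_⟩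
  · intro e he f hf hef
    by_contra hnot
    rw [Set.not_subsingleton_iff] at hnot
    have hefin := hfin.subset (H.subset_vertexSet_of_mem_edgeSet' he)
    have hffin := hfin.subset (H.subset_vertexSet_of_mem_edgeSet' hf)
    -- Two edges sharing two vertices span at most `2 * (r - 1)` vertices, one too few for `hcard`.
    have h1 := hconn.ncard_vertexSet_add_le hfin hunif {e, f} (e ∪ f)
      (insert_subset he (singleton_subset_iff.2 hf))
      (union_subset (H.subset_vertexSet_of_mem_edgeSet' he) (H.subset_vertexSet_of_mem_edgeSet' hf))
      (hnot.nonempty.mono fun x hx => Or.inl hx.1)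
      (by rintro g (rfl | rfl); exacts [subset_union_left, subset_union_right])
    have h2 := ncard_union_add_ncard_inter e f hefin hffin
    have h3 : 1 < (e ∩ f).ncard := by
      have := (hefin.inter_of_left f).to_subtype
      exact one_lt_ncard_iff_nontrivial.2 hnot
    rw [hunif e he, hunif f hf] at h2
    rw [ncard_pair hef] at h1
    omega
  · rintro ⟨l, e, v, hl, he, hv, heE, hve⟩
    have hefin : ∀ i, (e i).Finite := fun i =>
      hfin.subset (H.subset_vertexSet_of_mem_edgeSet' (heE i))
    -- Each `v i` survives in the next edge, whose deleted vertex is a different one. So the cycle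
    -- spans at most `(r - 1) * l` vertices, again one too few.
    have hU : (⋃ i, e i) = ⋃ i, (e i \ {v i}) := by
      refine subset_antisymm (fun x hx => ?_) (iUnion_mono fun i => sdiff_subset)
      obtain ⟨i, hi⟩ := mem_iUnion.1 hx
      by_cases hxi : x = v i
      · refine mem_iUnion.2 ⟨finRotate l i, hxi ▸ (hve i).2, fun h => ?_⟩
        have h4 : i = finRotate l i := hv (hxi.symm.trans h)
        obtain ⟨l, rfl⟩ : ∃ l', l = l' + 1 := ⟨l - 1, by omega⟩
        rw [finRotate_apply] at h4
        have h5 : (1 : Fin (l + 1)) = 0 := left_eq_add.1 h4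
        have h6 := congrArg Fin.val h5
        rw [Fin.val_one', Fin.val_zero, Nat.mod_eq_of_lt (by omega)] at h6
        omega
      · exact mem_iUnion.2 ⟨i, hi, hxi⟩
    have h1 := hconn.ncard_vertexSet_add_le hfin hunif (range e) (⋃ i, e i)
      (by rintro _ ⟨i, rfl⟩; exact heE i)
      (iUnion_subset fun i => H.subset_vertexSet_of_mem_edgeSet' (heE i))
      ⟨v ⟨0, by omega⟩, mem_iUnion.2 ⟨_, (hve ⟨0, by omega⟩).1⟩⟩
      (by rintro _ ⟨i, rfl⟩; exact subset_iUnion e i)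
    have h2 : (⋃ i, e i).ncard ≤ (r - 1) * l := by
      rw [hU]
      refine (ncard_iUnion_le_of_fintype _).trans ?_
      have : ∀ i, (e i \ {v i}).ncard = r - 1 := fun i => by
        rw [ncard_sdiff_singleton_of_mem (hve i).1, hunif _ (heE i)]
      simp [this, mul_comm]
    have h3 : (range e).ncard = l := by
      rw [← image_univ, ncard_image_of_injective _ he, ncard_univ, Nat.card_fin]
    rw [h3] at h1
    omega

/-- A chain of edges from `A` and vertices that links `u` to `v`. -/
structure IsLink (A : Set (Set α)) (u v : α) (l : ℕ) (e : ℕ → Set α) (w : ℕ → α) : Prop where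
  zero : w 0 = u
  last : w l = v
  mem : ∀ i < l, e i ∈ A
  left : ∀ i < l, w i ∈ e i
  right : ∀ i < l, w (i + 1) ∈ e i

theorem exists_isLink {A : Set (Set α)} {u v : α}
    (h : Relation.ReflTransGen (fun x y => ∃ e ∈ A, x ∈ e ∧ y ∈ e) u v) :
    ∃ l e w, IsLink A u v l e w := by
  induction h with
  | refl => exact ⟨0, fun _ => ∅, fun _ => u, rfl, rfl, by simp, by simp, by simp⟩
  | @tail b c _ hbc ih =>
    obtain ⟨l, e, w, h⟩ := ih
    obtain ⟨f, hf, hb, hc⟩ := hbc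
    refine ⟨l + 1, fun i => if i < l then e i else f, fun i => if i ≤ l then w i else c,
      by simp [h.zero], by simp, fun i hi => ?_, fun i hi => ?_, fun i hi => ?_⟩
    · by_cases hil : i < l
      · simpa [hil] using h.mem i hil
      · simpa [hil] using hf
    · by_cases hil : i < l
      · simpa [hil, hil.le] using h.left i hil
      · obtain rfl : i = l := by omega
        simpa [h.last] using hb
    · by_cases hil : i < l
      · simpa [hil, Nat.succ_le_iff] using h.right i hil
      · simpa [hil, Nat.succ_le_iff] using hc

/-- Distinct linked vertices are linked by a chain without repetitions. -/
theorem exists_isLink_injOn {A : Set (Set α)} {u v : α}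
    (h : Relation.ReflTransGen (fun x y => ∃ e ∈ A, x ∈ e ∧ y ∈ e) u v) :
    ∃ l e w, IsLink A u v l e w ∧ InjOn e {i | i < l} ∧ InjOn w {i | i ≤ l} := by
  classical
  have hex : ∃ l, ∃ e w, IsLink A u v l e w := exists_isLink h
  obtain ⟨e, w, hl⟩ := Nat.find_spec hex
  have hmin := fun m hm => Nat.find_min hex (m := m) hm
  set l := Nat.find hex
  -- A repetition at `i < j` allows the stretch between them to be cut out, contradicting minimality
  -- of `l`; the same splice serves for repeated vertices.
  have he : ∀ i j, i < j → j < l → e i ≠ e j := by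
    intro i j hij hjl heq
    refine hmin (l - (j - i)) (by omega) ⟨fun t => if t < i then e t else e (t + (j - i)),
      fun t => if t ≤ i then w t else w (t + (j - i)), by simp [hl.zero], ?_, ?_, ?_, ?_⟩
    · rw [if_neg (by omega), ← hl.last]
      congr 1; omega
    · intro t ht
      by_cases hti : t < i
      · simpa [hti] using hl.mem t (by omega)
      · simpa [hti] using hl.mem (t + (j - i)) (by omega)
    · intro t ht
      rcases lt_trichotomy t i with hti | rfl | hti
      · simpa [hti, hti.le] using hl.left t (by omega)
      · have : t + (j - t) = j := by omega
        simpa [this, ← heq] using hl.left t (by omega)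
      · simpa [hti.not_gt, hti.not_ge] using hl.left (t + (j - i)) (by omega)
    · intro t ht
      by_cases hti : t < i
      · simpa [hti, Nat.succ_le_iff] using hl.right t (by omega)
      · have : t + 1 + (j - i) = t + (j - i) + 1 := by omega
        simpa [hti, Nat.succ_le_iff, this] using hl.right (t + (j - i)) (by omega)
  have hw : ∀ i j, i < j → j ≤ l → w i ≠ w j := by
    intro i j hij hjl heq
    refine hmin (l - (j - i)) (by omega) ⟨fun t => if t < i then e t else e (t + (j - i)),
      fun t => if t ≤ i then w t else w (t + (j - i)), by simp [hl.zero], ?_, ?_, ?_, ?_⟩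
    · by_cases hjl' : j = l
      · rw [if_pos (by omega), ← hl.last, ← hjl', ← heq]
        congr 1; omega
      · rw [if_neg (by omega), ← hl.last]
        congr 1; omega
    · intro t ht
      by_cases hti : t < i
      · simpa [hti] using hl.mem t (by omega)
      · simpa [hti] using hl.mem (t + (j - i)) (by omega)
    · intro t ht
      rcases lt_trichotomy t i with hti | rfl | hti
      · simpa [hti, hti.le] using hl.left t (by omega)
      · have : t + (j - t) = j := by omega
        simpa [this, heq] using hl.left j (by omega)
      · simpa [hti.not_gt, hti.not_ge] using hl.left (t + (j - i)) (by omega)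
    · intro t ht
      by_cases hti : t < i
      · simpa [hti, Nat.succ_le_iff] using hl.right t (by omega)
      · have : t + 1 + (j - i) = t + (j - i) + 1 := by omega
        simpa [hti, Nat.succ_le_iff, this] using hl.right (t + (j - i)) (by omega)
  refine ⟨l, e, w, hl, fun i hi j hj hij => ?_, fun i hi j hj hij => ?_⟩
  · rcases lt_trichotomy i j with h1 | h1 | h1
    · exact absurd hij (he i j h1 hj)
    · exact h1
    · exact absurd hij.symm (he j i h1 hi)
  · rcases lt_trichotomy i j with h1 | h1 | h1
    · exact absurd hij (hw i j h1 hj)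
    · exact h1
    · exact absurd hij.symm (hw j i h1 hi)

/-- In a hypertree, two vertices of an edge are linked only through that edge. -/
theorem IsHypertree.eq_of_link (hH : H.IsHypertree) {A : Set (Set α)} (hA : A ⊆ H.edgeSet)
    {f : Set α} (hf : f ∈ H.edgeSet) (hfA : f ∉ A) {u v : α} (hu : u ∈ f) (hv : v ∈ f)
    (h : Relation.ReflTransGen (fun x y => ∃ e ∈ A, x ∈ e ∧ y ∈ e) u v) : u = v := by
  by_contra huv
  obtain ⟨l, e, w, hl, he, hw⟩ := exists_isLink_injOn h
  have hl0 : l ≠ 0 := by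
    rintro rfl
    exact huv (hl.zero.symm.trans hl.last)
  have hfe : ∀ i < l, e i ≠ f := fun i hi h => hfA (h ▸ hl.mem i hi)
  have hl1 : l ≠ 1 := by
    rintro rfl
    refine huv (hH.2.1 _ (hA (hl.mem 0 one_pos)) f hf (hfe 0 one_pos) ⟨?_, hu⟩ ⟨?_, hv⟩)
    · simpa [hl.zero] using hl.left 0 one_pos
    · simpa [hl.last] using hl.right 0 one_pos
  -- Closing the link with `f` gives a cycle. Vertices are shifted by one so that `w (i + 1)` joins
  -- `e i` to its successor, and `w 0 = u` joins `f` back to `e 0`.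
  refine hH.2.2 ⟨l + 1, fun i => if (i : ℕ) < l then e i else f,
    fun i => if (i : ℕ) < l then w (i + 1) else w 0, by omega, ?_, ?_, ?_, ?_⟩
  · intro i j hij
    have hi := i.2
    have hj := j.2
    ext
    by_cases hil : (i : ℕ) < l <;> by_cases hjl : (j : ℕ) < l <;>
      simp only [hil, hjl, if_true, if_false] at hij
    · exact he hil hjl hij
    · exact absurd hij (hfe _ hil)
    · exact absurd hij.symm (hfe _ hjl)
    · omega
  · intro i j hij
    have hi := i.2
    have hj := j.2
    ext
    by_cases hil : (i : ℕ) < l <;> by_cases hjl : (j : ℕ) < l <;>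
      simp only [hil, hjl, if_true, if_false] at hij
    · have := hw (show (i : ℕ) + 1 ≤ l from hil) (show (j : ℕ) + 1 ≤ l from hjl) hij
      omega
    · have := hw (show (i : ℕ) + 1 ≤ l from hil) (Nat.zero_le l) hij
      omega
    · have := hw (show (j : ℕ) + 1 ≤ l from hjl) (Nat.zero_le l) hij.symm
      omega
    · omega
  · intro i
    by_cases hil : (i : ℕ) < l
    · simpa [hil] using hA (hl.mem i hil)
    · simpa [hil] using hf
  · intro i
    by_cases hil : (i : ℕ) < l
    · have hrot : ((finRotate (l + 1) i : Fin (l + 1)) : ℕ) = i + 1 :=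
        coe_finRotate_of_ne_last (by intro h; simp [h] at hil)
      simp only [hil, if_true, hrot]
      refine ⟨hl.right i hil, ?_⟩
      by_cases hil' : (i : ℕ) + 1 < l
      · simpa [hil'] using hl.left _ hil'
      · have : (i : ℕ) + 1 = l := by omega
        simpa [this, hl.last] using hv
    · obtain rfl : i = Fin.last l := by
        ext
        have := i.2
        simp
        omega
      have hl00 : 0 < l := by omega
      simp only [finRotate_last, Fin.val_last, lt_irrefl, if_false, Fin.val_zero, hl00, if_true]
      exact ⟨by rw [hl.zero]; exact hu, hl.left 0 hl00⟩

end Structure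

end Hypergraph

namespace Hypergraph

/-! ### Every cover of a hypertree has enough colorings -/

section LowerBound

open Set

variable {α : Type*} {H : Hypergraph α}

theorem graph_subset_graph_iff {V κ : Type*} (φ : V →. κ) (f : V → κ) :
    φ.graph ⊆ (f : V →. κ).graph ↔ ∀ x, ∀ y ∈ φ x, f x = y :=
  ⟨fun h x _ hy => PFun.lift_graph.1 (h (show (x, _) ∈ φ.graph from hy)),
    fun h p hp => PFun.lift_graph.2 (h p.1 p.2 hp)⟩

theorem IsUniform.card_filter [Fintype H.vertexSet] {r : ℕ} (hunif : H.IsUniform r) {e : Set α}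
    (he : e ∈ H.edgeSet) [DecidablePred fun y : H.vertexSet => y.1 ∈ e] :
    (Finset.univ.filter fun y : H.vertexSet => y.1 ∈ e).card = r := by
  rw [← hunif e he, ← ncard_coe_finset, ← ncard_image_of_injective _ Subtype.val_injective]
  congr 1
  ext x
  simpa using fun hx => H.subset_vertexSet_of_mem_edgeSet' he hx

theorem IsUniform.card_filter_ne [Fintype H.vertexSet] {r : ℕ} (hunif : H.IsUniform r)
    {e : Set α} (he : e ∈ H.edgeSet) {x : H.vertexSet} (hx : x.1 ∈ e)
    [DecidablePred fun y : H.vertexSet => y.1 ∈ e ∧ y ≠ x] :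
    (Finset.univ.filter fun y : H.vertexSet => y.1 ∈ e ∧ y ≠ x).card = r - 1 := by
  classical
  rw [← hunif.card_filter he, ← Finset.card_erase_of_mem (a := x) (by simpa using hx)]
  congr 1
  ext y
  simp [and_comm]

/-- The maps avoiding the members of `F` whose domain belongs to `A`. -/
def partialColorings (H : Hypergraph α) (k : ℕ) (F : Set (H.vertexSet →. Fin k))
    (A : Set (Set α)) : Set (H.vertexSet → Fin k) :=
  {f | ∀ φ ∈ F, (Subtype.val '' φ.Dom : Set α) ∈ A → ¬ φ.graph ⊆ (f : H.vertexSet →. Fin k).graph}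

/-- Adding an edge that meets the previous ones in a single vertex loses at most the fraction
`1 / k ^ (r - 1)` of the colorings. -/
theorem IsCover.ncard_partialColorings_insert {r k : ℕ} [Finite H.vertexSet]
    (hunif : H.IsUniform r)
    {F : Set (H.vertexSet →. Fin k)} (hF : H.IsCover k F) {A : Set (Set α)} {W : Set α}
    (hAW : ∀ e ∈ A, e ⊆ W) {e : Set α} (he : e ∈ H.edgeSet) {x : α} (hx : x ∈ e)
    (hxW : ∀ y ∈ e, y ∈ W → y = x) :
    (H.partialColorings k F A).ncard * (k ^ (r - 1) - 1) ≤
      (H.partialColorings k F (insert e A)).ncard * k ^ (r - 1) := by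
  classical
  have := Fintype.ofFinite H.vertexSet
  obtain ⟨x, rfl⟩ : ∃ x' : H.vertexSet, x'.1 = x :=
    ⟨⟨x, H.subset_vertexSet_of_mem_edgeSet' he hx⟩, rfl⟩
  set G := H.partialColorings k F A with hG
  set B : Set (H.vertexSet → Fin k) := {f | f ∈ G ∧ ∃ φ ∈ F,
    (Subtype.val '' φ.Dom : Set α) = e ∧ φ.graph ⊆ (f : H.vertexSet →. Fin k).graph} with hB
  have hsub : G ⊆ H.partialColorings k F (insert e A) ∪ B := by
    intro f hf
    by_cases hfB : f ∈ B
    · exact Or.inr hfB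
    · refine Or.inl fun φ hφ hφA hle => ?_
      rcases hφA with hφe | hφA
      · exact hfB ⟨hf, φ, hφ, hφe, hle⟩
      · exact hf φ hφ hφA hle
  have hcard := (ncard_le_ncard hsub (toFinite _)).trans (ncard_union_le _ _)
  -- Recoloring `e` away from `x` touches no vertex of an edge in `A`, so a map of `B` stays in `G`.
  have hBG := card_mul_pow_le_of_modify
    (Finset.univ.filter fun y : H.vertexSet => y.1 ∈ e ∧ y ≠ x) B.toFinset G.toFinset ?_ ?_
  · rw [hunif.card_filter_ne he hx, Fintype.card_fin, ← ncard_eq_toFinset_card',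
      ← ncard_eq_toFinset_card'] at hBG
    rw [Nat.mul_sub, mul_one, Nat.sub_le_iff_le_add]
    calc G.ncard * k ^ (r - 1)
        ≤ ((H.partialColorings k F (insert e A)).ncard + B.ncard) * k ^ (r - 1) := by gcongr
      _ ≤ _ := by rw [add_mul]; gcongr
  · intro f hf g hgf
    rw [mem_toFinset] at hf ⊢
    intro φ hφ hφA hle
    refine hf.1 φ hφ hφA ?_
    rw [graph_subset_graph_iff] at hle ⊢
    intro y c hy
    rw [← hle y c hy]
    refine (hgf y fun hyT => ?_).symm
    rw [Finset.mem_filter] at hyT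
    exact hyT.2.2 (Subtype.ext (hxW _ hyT.2.1
      (hAW _ hφA ⟨y, (PFun.mem_dom _ _).2 ⟨c, hy⟩, rfl⟩)))
  · intro f hf g hg hfg
    rw [mem_toFinset] at hf hg
    obtain ⟨-, φ, hφ, hφe, hφf⟩ := hf
    obtain ⟨-, ψ, hψ, hψe, hψg⟩ := hg
    have hdom : φ.Dom = ψ.Dom := Subtype.val_injective.image_injective (hφe.trans hψe.symm)
    rw [graph_subset_graph_iff] at hφf hψg
    have hmem : ∀ y : H.vertexSet, y.1 ∈ e → f y ∈ φ y ∧ g y ∈ ψ y := by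
      intro y hy
      have hyφ : y ∈ φ.Dom := by
        rw [← hφe] at hy
        exact Subtype.val_injective.mem_set_image.1 hy
      obtain ⟨a, ha⟩ := (PFun.mem_dom _ _).1 hyφ
      obtain ⟨b, hb⟩ := (PFun.mem_dom _ _).1 (hdom ▸ hyφ)
      rw [hφf y a ha, hψg y b hb]
      exact ⟨ha, hb⟩
    -- Both members contain the same pair at `x`, and distinct members on `e` are disjoint.
    have hφψ : φ = ψ := by
      by_contra hne
      have hdisj := hF.2 φ hφ ψ hψ hne hdom
      have hmx : (x, f x) ∈ φ.graph ∩ ψ.graph := by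
        refine ⟨(hmem x hx).1, ?_⟩
        rw [hfg x (by simp)]
        exact (hmem x hx).2
      rw [hdisj] at hmx
      exact hmx
    funext y
    by_cases hy : y.1 ∈ e
    · have := (hmem y hy).2
      rw [← hφψ] at this
      exact hφf y _ this
    · exact hfg y (by simp [hy])

/-- Every cover of a hypertree has at least the average number of colorings. -/
theorem IsHypertree.le_ncard_coverColorings {r k : ℕ} (hr : 2 ≤ r)
    (hfin : H.vertexSet.Finite) (hne : H.vertexSet.Nonempty) (hunif : H.IsUniform r)
    (hH : H.IsHypertree) {F : Set (H.vertexSet →. Fin k)} (hF : H.IsCover k F) :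
    k ^ H.vertexSet.ncard * (k ^ (r - 1) - 1) ^ H.edgeSet.ncard ≤
      (H.coverColorings k F).ncard * k ^ ((r - 1) * H.edgeSet.ncard) := by
  classical
  have hEfin := edgeSet_finite hfin
  have : Finite H.vertexSet := hfin
  have key : ∀ j ≤ H.edgeSet.ncard, ∃ (A : Set (Set α)) (W : Set α),
      A ⊆ H.edgeSet ∧ A.ncard = j ∧ W ⊆ H.vertexSet ∧ W.Nonempty ∧ (∀ e ∈ A, e ⊆ W) ∧
      (∀ u ∈ W, ∀ v ∈ W, Relation.ReflTransGen (fun x y => ∃ e ∈ A, x ∈ e ∧ y ∈ e) u v) ∧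
      k ^ H.vertexSet.ncard * (k ^ (r - 1) - 1) ^ j ≤
        (H.partialColorings k F A).ncard * k ^ ((r - 1) * j) := by
    intro j
    induction j with
    | zero =>
      intro _
      obtain ⟨v, hv⟩ := hne
      refine ⟨∅, {v}, empty_subset _, ncard_empty _, singleton_subset_iff.2 hv,
        singleton_nonempty _, by simp, ?_, ?_⟩
      · rintro _ rfl _ rfl
        exact .refl
      · have : H.partialColorings k F ∅ = univ := by
          ext f
          simp [partialColorings]
        rw [this, ncard_univ, Nat.card_fun, Nat.card_fin, Nat.card_coe_set_eq]
        simp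
    | succ j ih =>
      intro hj
      obtain ⟨A, W, hAE, hAj, hWV, hWne, hAW, hlink, hcount⟩ := ih (by omega)
      -- Connectivity supplies an edge leaving `W`; once `W` is everything, any unused edge meets
      -- it.
      obtain ⟨e, he, heA, x, hxe, hxW⟩ : ∃ e ∈ H.edgeSet, e ∉ A ∧ (e ∩ W).Nonempty := by
        by_cases hW : W = H.vertexSet
        · obtain ⟨e, he, heA⟩ := exists_mem_notMem_of_ncard_lt_ncard
            (s := A) (t := H.edgeSet) (by omega) (hEfin.subset hAE)
          have : e.Nonempty := by
            rw [nonempty_iff_ne_empty]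
            rintro rfl
            have := hunif _ he
            rw [ncard_empty] at this
            omega
          refine ⟨e, he, heA, ?_⟩
          rwa [hW, inter_eq_left.2 (H.subset_vertexSet_of_mem_edgeSet' he)]
        · obtain ⟨e, he, hmeet, hout⟩ := hH.1.exists_edge_leaving hWV hWne hW
          exact ⟨e, he, fun h => hout (hAW e h), hmeet⟩
      have huniq : ∀ y ∈ e, y ∈ W → y = x := fun y hy hyW =>
        hH.eq_of_link hAE he heA hy hxe (hlink y hyW x hxW)
      refine ⟨insert e A, W ∪ e, insert_subset he hAE, ?_, ?_, hWne.mono subset_union_left, ?_,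
        ?_, ?_⟩
      · rw [ncard_insert_of_notMem heA (hEfin.subset hAE), hAj]
      · exact union_subset hWV (H.subset_vertexSet_of_mem_edgeSet' he)
      · rintro f (rfl | hf)
        · exact subset_union_right
        · exact (hAW f hf).trans subset_union_left
      · have hmono : ∀ u ∈ W, ∀ v ∈ W, Relation.ReflTransGen
            (fun x y => ∃ f ∈ insert e A, x ∈ f ∧ y ∈ f) u v := fun u hu v hv =>
          Relation.ReflTransGen.mono (fun _ _ ⟨f, hf, h⟩ => ⟨f, mem_insert_of_mem _ hf, h⟩)
            _ _ (hlink u hu v hv)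
        have hto : ∀ u ∈ W ∪ e, Relation.ReflTransGen
            (fun x y => ∃ f ∈ insert e A, x ∈ f ∧ y ∈ f) u x := by
          rintro u (hu | hu)
          · exact hmono u hu x hxW
          · exact .single ⟨e, mem_insert _ _, hu, hxe⟩
        have hfrom : ∀ u ∈ W ∪ e, Relation.ReflTransGen
            (fun x y => ∃ f ∈ insert e A, x ∈ f ∧ y ∈ f) x u := by
          rintro u (hu | hu)
          · exact hmono x hxW u hu
          · exact .single ⟨e, mem_insert _ _, hxe, hu⟩
        exact fun u hu v hv => (hto u hu).trans (hfrom v hv)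
      · have hstep := hF.ncard_partialColorings_insert hunif hAW he hxe huniq
        calc k ^ H.vertexSet.ncard * (k ^ (r - 1) - 1) ^ (j + 1)
            = k ^ H.vertexSet.ncard * (k ^ (r - 1) - 1) ^ j * (k ^ (r - 1) - 1) := by
              rw [pow_succ, mul_assoc]
          _ ≤ (H.partialColorings k F A).ncard * k ^ ((r - 1) * j) * (k ^ (r - 1) - 1) := by
              gcongr
          _ = (H.partialColorings k F A).ncard * (k ^ (r - 1) - 1) * k ^ ((r - 1) * j) := by
              ring
          _ ≤ (H.partialColorings k F (insert e A)).ncard * k ^ (r - 1) * k ^ ((r - 1) * j) := by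
              gcongr
          _ = _ := by ring
  obtain ⟨A, W, hAE, hAm, -, -, -, -, hcount⟩ := key _ le_rfl
  obtain rfl : A = H.edgeSet := eq_of_subset_of_ncard_le hAE hAm.ge hEfin
  have : H.partialColorings k F H.edgeSet = H.coverColorings k F := by
    ext f
    exact ⟨fun h φ hφ => h φ hφ (hF.1 φ hφ), fun h φ hφ _ => h φ hφ⟩
  rwa [this] at hcount

end LowerBound

end Hypergraph

namespace Hypergraph

/-! ### Shift covers and the equality case -/

section Average

open Set

variable {α : Type*} {H : Hypergraph α}

/-- The cover whose members on the edge `e` are the translates of the map `s e` by the colors. -/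
def shiftCover (H : Hypergraph α) (k : ℕ) (s : H.edgeSet → H.vertexSet → Fin k) :
    Set (H.vertexSet →. Fin k) :=
  {φ | ∃ (e : H.edgeSet) (c : Fin k), φ = PFun.res (fun x => s e x + c) (Subtype.val ⁻¹' e.1)}

theorem dom_res {V κ : Type*} (f : V → κ) (s : Set V) : (PFun.res f s).Dom = s := by
  ext x
  simp [PFun.mem_dom, PFun.mem_res]

/-- Translates of one map by different colors agree nowhere. -/
theorem isCover_shiftCover (k : ℕ) [NeZero k] (s : H.edgeSet → H.vertexSet → Fin k) :
    H.IsCover k (H.shiftCover k s) := by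
  have himage : ∀ e : H.edgeSet, Subtype.val '' (Subtype.val ⁻¹' e.1 : Set H.vertexSet) = e.1 :=
    fun e => by
      rw [Subtype.image_preimage_coe,
        inter_eq_right.2 (H.subset_vertexSet_of_mem_edgeSet' e.2)]
  refine ⟨?_, ?_⟩
  · rintro _ ⟨e, c, rfl⟩
    rw [dom_res, himage]
    exact e.2
  · rintro _ ⟨e, c, rfl⟩ _ ⟨e', c', rfl⟩ hne hdom
    rw [dom_res, dom_res] at hdom
    obtain rfl : e = e' := Subtype.ext (by rw [← himage e, hdom, himage])
    ext ⟨x, y⟩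
    simp only [mem_inter_iff, mem_empty_iff_false, iff_false]
    rintro ⟨h1, h2⟩
    have h1 := ((PFun.mem_res _ _ _ _).1 h1).2
    have h2 := ((PFun.mem_res _ _ _ _).1 h2).2
    have : c = c' := add_left_cancel (h1.trans h2.symm)
    exact hne (by rw [this])

theorem mem_coverColorings_shiftCover {k : ℕ} {s : H.edgeSet → H.vertexSet → Fin k}
    {f : H.vertexSet → Fin k} :
    f ∈ H.coverColorings k (H.shiftCover k s) ↔
      ∀ e : H.edgeSet, ¬ ∃ c, ∀ x : H.vertexSet, x.1 ∈ e.1 → f x = s e x + c := by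
  constructor
  · rintro h e ⟨c, hc⟩
    refine h _ ⟨e, c, rfl⟩ ((graph_subset_graph_iff _ _).2 fun x y hy => ?_)
    rw [PFun.mem_res] at hy
    exact (hc x hy.1).trans hy.2
  · rintro h _ ⟨e, c, rfl⟩ hle
    refine h e ⟨c, fun x hx => (graph_subset_graph_iff _ _).1 hle x _ ?_⟩
    exact (PFun.mem_res _ _ _ _).2 ⟨hx, rfl⟩

open Classical in
/-- The indicator that `f` avoids all translates of `s` on the edge `e`. -/
noncomputable def avoids (H : Hypergraph α) (k : ℕ) (e : H.edgeSet)
    (s f : H.vertexSet → Fin k) : ℚ :=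
  if ¬ ∃ c, ∀ x : H.vertexSet, x.1 ∈ e.1 → f x = s x + c then 1 else 0

theorem ncard_coverColorings_shiftCover [Fintype H.vertexSet]
    [DecidableEq H.vertexSet] [Fintype H.edgeSet] (k : ℕ)
    (s : H.edgeSet → H.vertexSet → Fin k) :
    ((H.coverColorings k (H.shiftCover k s)).ncard : ℚ) =
      ∑ f : H.vertexSet → Fin k, ∏ e, H.avoids k e (s e) f := by
  classical
  have h : ∀ f, ∏ e, H.avoids k e (s e) f =
      if f ∈ H.coverColorings k (H.shiftCover k s) then 1 else 0 := by
    intro f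
    unfold avoids
    split_ifs with hf
    · rw [mem_coverColorings_shiftCover] at hf
      exact Finset.prod_eq_one fun e _ => if_pos (hf e)
    · rw [mem_coverColorings_shiftCover, not_forall] at hf
      obtain ⟨e, he⟩ := hf
      exact Finset.prod_eq_zero (Finset.mem_univ e) (if_neg he)
  simp only [h, Finset.sum_boole]
  rw [← ncard_coe_finset]
  simp

/-- A map `s` blocks `f` on `e` exactly when `f - s` is constant there. Its value at one vertex of
`e` then forces the other `r - 1`, and `s` is free off `e`. -/
theorem IsUniform.sum_avoids {r k : ℕ} [NeZero k] [Fintype H.vertexSet]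
    [DecidableEq H.vertexSet] (hr : 2 ≤ r)
    (hunif : H.IsUniform r) (e : H.edgeSet) (f : H.vertexSet → Fin k) :
    ∑ s, H.avoids k e s f =
      Fintype.card (H.vertexSet → Fin k) * (1 - 1 / (k : ℚ) ^ (r - 1)) := by
  classical
  obtain ⟨x, hx⟩ : e.1.Nonempty := by
    rw [nonempty_iff_ne_empty]
    intro h
    have := hunif _ e.2
    rw [h, ncard_empty] at this
    omega
  obtain ⟨x, rfl⟩ : ∃ x' : H.vertexSet, x'.1 = x :=
    ⟨⟨x, H.subset_vertexSet_of_mem_edgeSet' e.2 hx⟩, rfl⟩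
  have hcard := card_mul_pow_eq_of_modify
    (Finset.univ.filter fun y : H.vertexSet => y.1 ∈ e.1 ∧ y ≠ x)
    (Finset.univ.filter fun s : H.vertexSet → Fin k =>
      ∃ c, ∀ x : H.vertexSet, x.1 ∈ e.1 → f x = s x + c) Finset.univ
    (fun _ _ _ _ => Finset.mem_univ _) ?_ ?_
  · rw [hunif.card_filter_ne e.2 hx, Fintype.card_fin, Finset.card_univ] at hcard
    have hk : (k : ℚ) ^ (r - 1) ≠ 0 := pow_ne_zero _ (NeZero.ne _)
    have hsplit : ∀ s, H.avoids k e s f =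
        1 - if ∃ c, ∀ x : H.vertexSet, x.1 ∈ e.1 → f x = s x + c then 1 else 0 := by
      intro s
      unfold avoids
      split_ifs <;> simp_all
    simp only [hsplit, Finset.sum_sub_distrib, Finset.sum_boole, Finset.sum_const,
      Finset.card_univ, nsmul_eq_mul, mul_one]
    rw [← hcard]
    push_cast
    field_simp
  · intro s hs t ht hst
    obtain ⟨c, hc⟩ := (Finset.mem_filter.1 hs).2
    obtain ⟨d, hd⟩ := (Finset.mem_filter.1 ht).2
    have hcd : c = d := by
      have := (hc x hx).symm.trans (hd x hx)
      rw [hst x (by simp)] at this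
      exact add_left_cancel this
    funext y
    by_cases hy : y.1 ∈ e.1
    · have := (hc y hy).symm.trans (hd y hy)
      rw [hcd] at this
      exact add_right_cancel this
    · exact hst y (by simp [hy])
  · intro g _
    -- The constant difference is read off at `x`, where `g` must be kept.
    refine ⟨fun y => if y.1 ∈ e.1 then f y - (f x - g x) else g y, ?_, ?_⟩
    · simp only [Finset.mem_filter, Finset.mem_univ, true_and]
      exact ⟨f x - g x, fun y hy => by simp [hy]⟩
    · intro y hy
      by_cases hye : y.1 ∈ e.1
      · have : y = x := by
          by_contra hne
          exact hy (by simp [hye, hne])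
        subst this
        simp [hye]
      · simp [hye]

/-- On a connected hypergraph, exactly `k` maps to `k` colors are constant on every edge. -/
theorem IsConnected.card_monochromatic {k : ℕ} [NeZero k] [Fintype H.vertexSet]
    [DecidableEq H.vertexSet]
    [Fintype H.edgeSet] (hne : H.vertexSet.Nonempty) (hconn : H.IsConnected) :
    ∑ f : H.vertexSet → Fin k, ∏ e : H.edgeSet, (1 - H.avoids k e 0 f) = k := by
  classical
  have hsplit : ∀ (e : H.edgeSet) (f : H.vertexSet → Fin k), 1 - H.avoids k e 0 f =
      if ∃ c, ∀ x : H.vertexSet, x.1 ∈ e.1 → f x = c then 1 else 0 := by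
    intro e f
    unfold avoids
    simp only [Pi.zero_apply, zero_add]
    split_ifs <;> simp_all
  simp only [hsplit, Finset.prod_boole, Finset.mem_univ, true_implies, Finset.sum_boole]
  congr 1
  obtain ⟨v, hv⟩ := hne
  conv_rhs => rw [← Fintype.card_fin k, ← Finset.card_univ (α := Fin k)]
  refine Finset.card_bij' (fun f _ => f ⟨v, hv⟩) (fun c _ => fun _ => c) (by simp) ?_ ?_ (by simp)
  · intro c _
    simp only [Finset.mem_filter, Finset.mem_univ, true_and]
    exact fun e => ⟨c, fun _ _ => rfl⟩
  · intro f hf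
    have hf := (Finset.mem_filter.1 hf).2
    -- An edge leaving the color class of `v` could not be monochromatic.
    set W : Set α := Subtype.val '' {x : H.vertexSet | f x = f ⟨v, hv⟩} with hW
    have hWV : W = H.vertexSet := by
      by_contra hWV
      obtain ⟨e, he, ⟨x, hxe, ⟨x, hxf, rfl⟩⟩, hout⟩ := hconn.exists_edge_leaving
        (W := W) (by rintro _ ⟨x, -, rfl⟩; exact x.2) ⟨v, ⟨v, hv⟩, rfl, rfl⟩ hWV
      obtain ⟨c, hc⟩ := hf ⟨e, he⟩
      refine hout fun y hy => ⟨⟨y, H.subset_vertexSet_of_mem_edgeSet' he hy⟩, ?_, rfl⟩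
      rw [mem_ofPred_eq, hc _ hy, ← hc x hxe]
      exact hxf
    funext y
    have hy : y.1 ∈ W := hWV.symm ▸ y.2
    obtain ⟨z, hz, hzy⟩ := hy
    rw [← Subtype.ext hzy]
    exact hz.symm

theorem dpColorFunction_le {k : ℕ} {F : Set (H.vertexSet →. Fin k)} (hF : H.IsCover k F) :
    H.dpColorFunction k ≤ (H.coverColorings k F).ncard :=
  Nat.sInf_le ⟨F, hF, rfl⟩

theorem exists_isCover_dpColorFunction_eq (H : Hypergraph α) (k : ℕ) :
    ∃ F, H.IsCover k F ∧ H.dpColorFunction k = (H.coverColorings k F).ncard :=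
  Nat.sInf_mem (s := {N | ∃ F, H.IsCover k F ∧ N = (H.coverColorings k F).ncard})
    ⟨_, ∅, ⟨by simp, by simp⟩, rfl⟩

/-- The mean is written as a sum of constants, ready for termwise comparison. -/
theorem sum_ncard_coverColorings_shiftCover {r k : ℕ} [NeZero k] [Fintype H.vertexSet]
    [DecidableEq H.vertexSet]
    [Fintype H.edgeSet]
    [DecidableEq H.edgeSet]
    (hr : 2 ≤ r) (hunif : H.IsUniform r) :
    ∑ s : H.edgeSet → H.vertexSet → Fin k,
        ((H.coverColorings k (H.shiftCover k s)).ncard : ℚ) =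
      ∑ _s : H.edgeSet → H.vertexSet → Fin k,
        (Fintype.card (H.vertexSet → Fin k) : ℚ) *
          (1 - 1 / (k : ℚ) ^ (r - 1)) ^ Fintype.card H.edgeSet := by
  simp only [ncard_coverColorings_shiftCover]
  rw [sum_sum_prod_eq (H.avoids k) _ (hunif.sum_avoids hr)]
  rw [Finset.sum_const, Finset.card_univ, nsmul_eq_mul, Fintype.card_fun (α := H.edgeSet),
    mul_pow]
  push_cast
  ring

/-- The DP color function is at most the average number of colorings of a shift cover. -/
theorem IsUniform.dpColorFunction_le_average {r k : ℕ} [NeZero k] [Fintype H.vertexSet]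
    [DecidableEq H.vertexSet]
    [Fintype H.edgeSet] (hr : 2 ≤ r) (hunif : H.IsUniform r) :
    (H.dpColorFunction k : ℚ) ≤ (Fintype.card (H.vertexSet → Fin k) : ℚ) *
      (1 - 1 / (k : ℚ) ^ (r - 1)) ^ Fintype.card H.edgeSet := by
  classical
  obtain ⟨s, -, hs⟩ := Finset.exists_le_of_sum_le Finset.univ_nonempty
    (sum_ncard_coverColorings_shiftCover (H := H) (k := k) hr hunif).le
  refine le_trans ?_ hs
  exact_mod_cast dpColorFunction_le (isCover_shiftCover k s)

/-- If the DP color function attains the average, then there are as many vertices as in a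
hypertree. -/
theorem IsConnected.ncard_eq_of_dpColorFunction_eq {r k : ℕ} (hk : 2 ≤ k) [Fintype H.vertexSet]
    [DecidableEq H.vertexSet]
    [Fintype H.edgeSet] (hr : 2 ≤ r) (hne : H.vertexSet.Nonempty) (hunif : H.IsUniform r)
    (hconn : H.IsConnected)
    (h : (H.dpColorFunction k : ℚ) = (Fintype.card (H.vertexSet → Fin k) : ℚ) *
      (1 - 1 / (k : ℚ) ^ (r - 1)) ^ Fintype.card H.edgeSet) :
    Fintype.card H.vertexSet = (r - 1) * Fintype.card H.edgeSet + 1 := by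
  classical
  have : NeZero k := ⟨by omega⟩
  have hσ : ∀ s : H.edgeSet → H.vertexSet → Fin k,
      ∑ f, ∏ e, H.avoids k e (s e) f = (Fintype.card (H.vertexSet → Fin k) : ℚ) *
        (1 - 1 / (k : ℚ) ^ (r - 1)) ^ Fintype.card H.edgeSet := by
    intro s
    rw [← ncard_coverColorings_shiftCover]
    have hle : ∀ s ∈ (Finset.univ : Finset (H.edgeSet → H.vertexSet → Fin k)),
        (Fintype.card (H.vertexSet → Fin k) : ℚ) *
          (1 - 1 / (k : ℚ) ^ (r - 1)) ^ Fintype.card H.edgeSet ≤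
        ((H.coverColorings k (H.shiftCover k s)).ncard : ℚ) := by
      intro s _
      rw [← h]
      exact_mod_cast dpColorFunction_le (isCover_shiftCover k s)
    -- No term lies below the mean, so all equal it.
    exact ((Finset.sum_eq_sum_iff_of_le hle).1
      (sum_ncard_coverColorings_shiftCover hr hunif).symm s (Finset.mem_univ s)).symm
  have hk1 : (1 : ℚ) < (k : ℚ) ^ (r - 1) :=
    one_lt_pow₀ (by exact_mod_cast hk) (by omega)
  -- This is where `k ≥ 2` enters: for `k = 1` the factor vanishes and cannot be cancelled.
  have hp : (1 - 1 / (k : ℚ) ^ (r - 1)) ≠ 0 := by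
    have : 1 / (k : ℚ) ^ (r - 1) < 1 := (div_lt_one (by linarith)).2 hk1
    linarith
  have hmono := sum_prod_one_sub_eq (H.avoids k) _ hp (hunif.sum_avoids hr) hσ fun _ => 0
  rw [hconn.card_monochromatic hne, Fintype.card_fun, Fintype.card_fin, sub_sub_cancel, one_div,
    inv_pow, ← div_eq_mul_inv, eq_div_iff (by positivity), ← pow_mul] at hmono
  have hmono : k ^ ((r - 1) * Fintype.card H.edgeSet + 1) = k ^ Fintype.card H.vertexSet := by
    rw [pow_succ']
    exact_mod_cast hmono
  exact (Nat.pow_right_injective hk hmono).symm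

end Average

end Hypergraph

theorem mainTheorem1 {α : Type*} (H : Hypergraph α) (r n m : ℕ) (hr : 2 ≤ r)
    (hfin : H.vertexSet.Finite) (hne : H.vertexSet.Nonempty)
    (hn : H.vertexSet.ncard = n) (hm : H.edgeSet.ncard = m)
    (hunif : H.IsUniform r) (hconn : H.IsConnected) :
    ((∀ k : ℕ, 1 ≤ k →
        (H.dpColorFunction k : ℚ) =
          (k : ℚ) ^ n * ((k : ℚ) ^ (r - 1) - 1) ^ m / (k : ℚ) ^ ((r - 1) * m)) ↔
      H.IsHypertree) ∧
    (∀ k : ℕ, 2 ≤ k →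
      ((H.dpColorFunction k : ℚ) =
          (k : ℚ) ^ n * ((k : ℚ) ^ (r - 1) - 1) ^ m / (k : ℚ) ^ ((r - 1) * m) ↔
        H.IsHypertree)) := by
  classical
  have hV : Fintype H.vertexSet := hfin.fintype
  have hE : Fintype H.edgeSet := (Hypergraph.edgeSet_finite hfin).fintype
  have hn' : Fintype.card H.vertexSet = n := by
    rw [← hn, ← Nat.card_coe_set_eq, Nat.card_eq_fintype_card]
  have hm' : Fintype.card H.edgeSet = m := by
    rw [← hm, ← Nat.card_coe_set_eq, Nat.card_eq_fintype_card]
  have hform : ∀ k : ℕ, 1 ≤ k →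
      (k : ℚ) ^ n * ((k : ℚ) ^ (r - 1) - 1) ^ m / (k : ℚ) ^ ((r - 1) * m) =
        (Fintype.card (H.vertexSet → Fin k) : ℚ) *
          (1 - 1 / (k : ℚ) ^ (r - 1)) ^ Fintype.card H.edgeSet := by
    intro k hk
    have hk0 : (k : ℚ) ^ (r - 1) ≠ 0 := pow_ne_zero _ (by exact_mod_cast (by omega : k ≠ 0))
    rw [Fintype.card_fun, Fintype.card_fin, hn', hm', pow_mul, mul_div_assoc, ← div_pow, sub_div,
      div_self hk0]
    push_cast
    rfl
  have hback : ∀ k : ℕ, 2 ≤ k → (H.dpColorFunction k : ℚ) =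
      (k : ℚ) ^ n * ((k : ℚ) ^ (r - 1) - 1) ^ m / (k : ℚ) ^ ((r - 1) * m) →
        H.IsHypertree := by
    intro k hk h
    rw [hform k (by omega)] at h
    have := hconn.ncard_eq_of_dpColorFunction_eq hk hr hne hunif h
    rw [hn', hm'] at this
    exact hconn.isHypertree_of_ncard hr hfin hunif (by rw [hn, hm, this])
  have hforw : H.IsHypertree → ∀ k : ℕ, 1 ≤ k → (H.dpColorFunction k : ℚ) =
      (k : ℚ) ^ n * ((k : ℚ) ^ (r - 1) - 1) ^ m / (k : ℚ) ^ ((r - 1) * m) := by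
    intro hH k hk
    have : NeZero k := ⟨by omega⟩
    refine le_antisymm ?_ ?_
    · rw [hform k hk]
      exact hunif.dpColorFunction_le_average hr
    · obtain ⟨F, hF, hFeq⟩ := H.exists_isCover_dpColorFunction_eq k
      have hle := hH.le_ncard_coverColorings hr hfin hne hunif hF
      rw [← hFeq, hn, hm] at hle
      have hk0 : (0 : ℚ) < k := by exact_mod_cast hk
      rw [div_le_iff₀ (by positivity)]
      -- The lower bound was proved with truncated subtraction, harmless since `k ≥ 1`.
      have hcast : ((k ^ (r - 1) - 1 : ℕ) : ℚ) = (k : ℚ) ^ (r - 1) - 1 := by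
        rw [Nat.cast_sub (Nat.one_le_pow _ _ hk)]
        push_cast
        rfl
      rw [← hcast]
      exact_mod_cast hle
  exact ⟨⟨fun h => hback 2 le_rfl (h 2 one_le_two), hforw⟩,
    fun k hk => ⟨hback k hk, fun h => hforw h k (by omega)⟩⟩
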